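/- There are universal constants $C>0$ and $\varepsilon>0$ such that the following holds. Let $1.99\le c\le 2$, let $r$ be a positive integer, let $\Delta$ be a real number with $r^{-1/10}\le\Delta<1$, and suppose that $m=\frac{c\log r}{\log(1/\Delta)}$ is an integer. Let $k$ be a positive integer with $r\ge C\binom{m+k}{k}$. Then there exist unit vectors $v_1,\dots,v_r\in\mathbb S^{m-1}\subset\mathbb R^m$ and weights $w_1,\dots,w_r\ge 0$ with $\sum_{\ell=1}^r w_\ell=1$ such that: 1. for $g(z)=\sum_{\ell=1}^r w_\ell\,\mathrm{sign}(\langle v_\ell,z\rangle)$, where $\mathrm{sign}(t)=1$ for $t\ge 0$ and $\mathrm{sign}(t)=-1$ for $t<0$, and for every real polynomial $p$ in $m$ variables that is odd ($p(-z)=-p(z)$ for all $z$) and of degree less than $k$, the function $g\,p$ is integrable with respect to the standard Gaussian measure $\mathcal N_m$ on $\mathbb R^m$ and $\mathbf E_{z\sim\mathcal N_m}[g(z)p(z)]=0$; 2. $\|v_i+v_j\|_2\ge\varepsilon\Delta$ and $\|v_i-v_j\|_2\ge\varepsilon\Delta$ for all $1\le i<j\le r$. -/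

import Mathlib

open MeasureTheory ProbabilityTheory

noncomputable section

/-- The sign function of linear classifiers: `1` for `t ≥ 0`, and `-1` otherwise. -/
def ltfSign (t : ℝ) : ℝ := if 0 ≤ t then 1 else -1

/-- The mean label `g(z) = ∑ w_ℓ sign(⟨v_ℓ, z⟩)` of the mixture of the linear classifiers with
weight vectors `v_ℓ` and mixing weights `w_ℓ`. -/
def mixtureLTF {m r : ℕ} (v : Fin r → EuclideanSpace ℝ (Fin m)) (w : Fin r → ℝ)
    (z : EuclideanSpace ℝ (Fin m)) : ℝ :=
  ∑ l, w l * ltfSign (inner ℝ (v l) z)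

/-- The value of a real polynomial in `m` variables at a point of Euclidean space. -/
def polyEval {m : ℕ} (p : MvPolynomial (Fin m) ℝ) (z : EuclideanSpace ℝ (Fin m)) : ℝ :=
  MvPolynomial.eval (fun i => z i) p

end

/-! Choose `r` unit vectors whose lines are well separated; a volume count allows this because `r *
Δ ^ (m - 1) ≤ 1`. Each vector gives a vector of Gaussian moments of its sign function, indexed by
the monomials of degree at most `k`. There are at most `(m + k).choose k < r` such monomials, so the
moment vectors satisfy a nontrivial relation with coefficients `a l`. Against an odd polynomial,
replacing `v l` by `-v l` negates the integral, so flipping the vectors with `a l < 0` turns the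
relation into one with weights `|a l|`, which are then normalised. Flips at most swap `‖v i + v j‖`
and `‖v i - v j‖`, so separation up to sign survives. -/

section Packing

variable {E : Type*} [NormedAddCommGroup E] [NormedSpace ℝ E] [FiniteDimensional ℝ E]

/-- Volume bound for a `δ`-net of the unit sphere. -/
lemma le_card_mul_pow_of_sphere_cover [Nontrivial E] (t : Finset E) {δ : ℝ} (hδ : 0 < δ)
    (hδ1 : δ ≤ 1) (ht : ∀ u : E, ‖u‖ = 1 → ∃ v ∈ t, ‖u - v‖ < δ) :
    δ ≤ 2 * t.card * (2 * δ) ^ Module.finrank ℝ E := by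
  borelize E
  let μ : Measure E := Measure.addHaar
  set J := ⌊1 / δ⌋₊ with hJ
  -- Discretise the radius too: the centres are the multiples `j * δ` of net points. The `J + 1 ≤ 2
  -- / δ` radii account for the factor `δ` on the left of the bound.
  have hcover : Metric.ball (0 : E) 1 ⊆
      ⋃ p ∈ t ×ˢ Finset.range (J + 1), Metric.ball (((p.2 : ℝ) * δ) • p.1) (2 * δ) := by
    intro x hx
    rw [mem_ball_zero_iff] at hx
    obtain ⟨u, hu, hxu⟩ : ∃ u : E, ‖u‖ = 1 ∧ x = ‖x‖ • u := by
      rcases eq_or_ne x 0 with rfl | hx0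
      · obtain ⟨u, hu⟩ := exists_norm_eq E zero_le_one
        exact ⟨u, hu, by simp⟩
      · refine ⟨‖x‖⁻¹ • x, norm_smul_inv_norm hx0, ?_⟩
        rw [smul_smul, mul_inv_cancel₀ (norm_ne_zero_iff.2 hx0), one_smul]
    obtain ⟨v, hvt, hv⟩ := ht u hu
    set s := ‖x‖ with hs
    have hs0 : 0 ≤ s := norm_nonneg x
    set j := ⌊s / δ⌋₊ with hj
    have hj1 : (j : ℝ) * δ ≤ s := (le_div_iff₀ hδ).1 (Nat.floor_le (by positivity))
    have hj2 : s < ((j : ℝ) + 1) * δ := (div_lt_iff₀ hδ).1 (Nat.lt_floor_add_one _)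
    have hjJ : j ≤ J := Nat.floor_mono (by gcongr)
    simp only [Set.mem_iUnion]
    refine ⟨(v, j), by simpa [hvt] using Nat.lt_succ_of_le hjJ, ?_⟩
    rw [mem_ball_iff_norm]
    have hdec : x - ((j : ℝ) * δ) • v = (s - j * δ) • u + ((j : ℝ) * δ) • (u - v) := by
      rw [hxu]; module
    have h0 : 0 ≤ (j : ℝ) * δ := by positivity
    calc ‖x - ((j : ℝ) * δ) • v‖
        ≤ ‖(s - j * δ) • u‖ + ‖((j : ℝ) * δ) • (u - v)‖ := hdec ▸ norm_add_le _ _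
      _ = (s - j * δ) + (j * δ) * ‖u - v‖ := by
          rw [norm_smul, norm_smul, hu, Real.norm_of_nonneg (sub_nonneg.2 hj1),
            Real.norm_of_nonneg h0, mul_one]
      _ < 2 * δ := by nlinarith [norm_nonneg (u - v)]
  have hpos : 0 < μ.real (Metric.ball (0 : E) 1) :=
    ENNReal.toReal_pos (Metric.measure_ball_pos μ _ one_pos).ne' measure_ball_lt_top.ne
  have hball (x : E) : μ.real (Metric.ball x (2 * δ)) =
      (2 * δ) ^ Module.finrank ℝ E * μ.real (Metric.ball (0 : E) 1) := by
    rw [measureReal_def, Measure.addHaar_ball μ x (by positivity : 0 ≤ 2 * δ), ENNReal.toReal_mul,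
      ENNReal.toReal_ofReal (by positivity), measureReal_def]
  have hvol : μ.real (Metric.ball (0 : E) 1) ≤
      (t.card * (J + 1) * (2 * δ) ^ Module.finrank ℝ E) * μ.real (Metric.ball (0 : E) 1) := by
    calc μ.real (Metric.ball (0 : E) 1) ≤ μ.real (⋃ p ∈ t ×ˢ Finset.range (J + 1),
          Metric.ball (((p.2 : ℝ) * δ) • p.1) (2 * δ)) :=
        measureReal_mono hcover ((measure_biUnion_lt_top (Finset.finite_toSet _)
          fun _ _ => measure_ball_lt_top).ne)
      _ ≤ ∑ p ∈ t ×ˢ Finset.range (J + 1),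
          μ.real (Metric.ball (((p.2 : ℝ) * δ) • p.1) (2 * δ)) := measureReal_biUnion_finset_le _ _
      _ = _ := by
        simp only [hball, Finset.sum_const, Finset.card_product, Finset.card_range, nsmul_eq_mul]
        push_cast
        ring
  have h1 : 1 ≤ t.card * ((J : ℝ) + 1) * (2 * δ) ^ Module.finrank ℝ E :=
    le_of_mul_le_mul_right (by simpa using hvol) hpos
  have hJδ : ((J : ℝ) + 1) * δ ≤ 2 := by
    have : (J : ℝ) * δ ≤ 1 := (le_div_iff₀ hδ).1 (Nat.floor_le (by positivity))
    linarith
  calc δ = δ * 1 := (mul_one δ).symm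
    _ ≤ δ * (t.card * ((J : ℝ) + 1) * (2 * δ) ^ Module.finrank ℝ E) := by gcongr
    _ = (((J : ℝ) + 1) * δ) * (t.card * (2 * δ) ^ Module.finrank ℝ E) := by ring
    _ ≤ 2 * (t.card * (2 * δ) ^ Module.finrank ℝ E) := by gcongr
    _ = _ := by ring

/-- Greedy packing of lines: unit vectors that are pairwise separated up to sign. -/
lemma exists_finset_sphere_separated [Nontrivial E] {δ : ℝ} (hδ : 0 < δ) (hδ1 : δ ≤ 1) (n : ℕ)
    (hn : 4 * n * (2 * δ) ^ Module.finrank ℝ E ≤ δ) :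
    ∃ t : Finset E, t.card = n ∧ (∀ v ∈ t, ‖v‖ = 1) ∧
      (t : Set E).Pairwise fun x y => δ ≤ ‖x + y‖ ∧ δ ≤ ‖x - y‖ := by
  classical
  induction n with
  | zero => exact ⟨∅, by simp⟩
  | succ n ih =>
    have hp : 0 < (2 * δ) ^ Module.finrank ℝ E := by positivity
    push_cast at hn
    obtain ⟨t, hcard, hunit, hsep⟩ := ih (by nlinarith)
    obtain ⟨u, hu, hut⟩ : ∃ u : E, ‖u‖ = 1 ∧ ∀ v ∈ t, δ ≤ ‖u + v‖ ∧ δ ≤ ‖u - v‖ := by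
      by_contra! hcon
      -- If `t` cannot be extended, `t` and its antipodes form a `δ`-net of at most `2 * n` points,
      -- too few by the volume bound.
      have h := le_card_mul_pow_of_sphere_cover (t ∪ t.image Neg.neg) hδ hδ1 fun u hu => by
        obtain ⟨v, hv, huv⟩ := hcon u hu
        by_cases h : δ ≤ ‖u + v‖
        · exact ⟨v, Finset.mem_union_left _ hv, huv h⟩
        · exact ⟨-v, Finset.mem_union_right _ (Finset.mem_image_of_mem _ hv),
            by simpa using h⟩
      have hc : ((t ∪ t.image Neg.neg).card : ℝ) ≤ 2 * n := by
        have := (Finset.card_union_le t (t.image Neg.neg)).trans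
          (Nat.add_le_add_left Finset.card_image_le _)
        rw [hcard] at this
        exact_mod_cast this.trans_eq (two_mul n).symm
      nlinarith
    have hut' : u ∉ t := fun h => by
      have := (hut u h).2
      rw [sub_self, norm_zero] at this
      exact this.not_gt hδ
    refine ⟨insert u t, by rw [Finset.card_insert_of_notMem hut', hcard], ?_, ?_⟩
    · simpa [hu] using hunit
    · rw [Finset.coe_insert]
      have hsymm : Std.Symm fun x y : E => δ ≤ ‖x + y‖ ∧ δ ≤ ‖x - y‖ :=
        ⟨fun x y h => by rwa [add_comm, norm_sub_rev]⟩
      exact hsep.insert_of_symm fun v hv _ => hut v hv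

lemma exists_sphere_family_separated [Nontrivial E] {δ : ℝ} (hδ : 0 < δ) (hδ1 : δ ≤ 1) (n : ℕ)
    (hn : 4 * n * (2 * δ) ^ Module.finrank ℝ E ≤ δ) :
    ∃ v : Fin n → E, (∀ i, ‖v i‖ = 1) ∧
      ∀ i j, i ≠ j → δ ≤ ‖v i + v j‖ ∧ δ ≤ ‖v i - v j‖ := by
  obtain ⟨t, hcard, hunit, hsep⟩ := exists_finset_sphere_separated (E := E) hδ hδ1 n hn
  let e := (Finset.equivFinOfCardEq hcard).symm
  refine ⟨fun i => e i, fun i => hunit _ (e i).2, fun i j hij => hsep (e i).2 (e j).2 ?_⟩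
  exact fun h => hij (e.injective (Subtype.ext h))

end Packing

section Exponents

/-- Exponents of the monomials in `m` variables of degree at most `k`. -/
lemma exists_finset_degree_le (m k : ℕ) :
    ∃ S : Finset (Fin m →₀ ℕ), S.card ≤ (m + k).choose k ∧
      ∀ d : Fin m →₀ ℕ, (d.sum fun _ e => e) ≤ k → d ∈ S := by
  classical
  -- Homogenise: the extra variable `none` absorbs the missing degree.
  refine ⟨((Finset.univ : Finset (Option (Fin m))).finsuppAntidiag k).image Finsupp.some, ?_, ?_⟩
  · refine Finset.card_image_le.trans ?_
    rw [Finset.card_finsuppAntidiag_nat_eq_choose]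
    simp only [Finset.card_univ, Fintype.card_option, Fintype.card_fin]
    rw [show m + 1 + k - 1 = m + k by omega]
  · intro d hd
    refine Finset.mem_image.2 ⟨d.optionElim (k - d.sum fun _ e => e), ?_, Finsupp.some_optionElim _ _⟩
    rw [Finset.mem_finsuppAntidiag]
    refine ⟨?_, Finset.subset_univ _⟩
    rw [Fintype.sum_option]
    simp only [Finsupp.optionElim_apply_none, Finsupp.optionElim_apply_some]
    rw [← Finsupp.sum_fintype d (fun _ e => e) (fun _ => rfl)]
    omega

end Exponents

section Gaussian

variable {m : ℕ}

lemma measurable_ltfSign : Measurable ltfSign :=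
  Measurable.ite measurableSet_Ici measurable_const measurable_const

lemma abs_ltfSign_le (t : ℝ) : |ltfSign t| ≤ 1 := by
  unfold ltfSign
  split_ifs <;> simp

lemma integrable_monomial_stdGaussian (d : Fin m →₀ ℕ) :
    Integrable (fun z : EuclideanSpace ℝ (Fin m) => ∏ i, z i ^ d i)
      (stdGaussian (EuclideanSpace ℝ (Fin m))) := by
  have h := (IsGaussian.memLp_id (stdGaussian (EuclideanSpace ℝ (Fin m)))
    ((∑ i, d i : ℕ)) (ENNReal.natCast_ne_top _)).integrable_norm_pow'
  refine h.mono' (by fun_prop) (ae_of_all _ fun z => ?_)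
  rw [norm_prod, ← Finset.prod_pow_eq_pow_sum]
  refine Finset.prod_le_prod (fun _ _ => norm_nonneg _) fun i _ => ?_
  rw [norm_pow]
  exact pow_le_pow_left₀ (norm_nonneg _) (PiLp.norm_apply_le z i) _

lemma polyEval_eq_sum (p : MvPolynomial (Fin m) ℝ) (z : EuclideanSpace ℝ (Fin m)) :
    polyEval p z = ∑ d ∈ p.support, p.coeff d * ∏ i, z i ^ d i :=
  MvPolynomial.eval_eq' _ _

lemma integrable_polyEval (p : MvPolynomial (Fin m) ℝ) :
    Integrable (polyEval p) (stdGaussian (EuclideanSpace ℝ (Fin m))) := by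
  rw [show polyEval p = _ from funext (polyEval_eq_sum p)]
  exact integrable_finsetSum _ fun d _ => (integrable_monomial_stdGaussian d).const_mul _

lemma integrable_ltfSign_mul {f : EuclideanSpace ℝ (Fin m) → ℝ}
    (hf : Integrable f (stdGaussian (EuclideanSpace ℝ (Fin m))))
    (v : EuclideanSpace ℝ (Fin m)) :
    Integrable (fun z => ltfSign (inner ℝ v z) * f z)
      (stdGaussian (EuclideanSpace ℝ (Fin m))) :=
  hf.bdd_mul (c := 1) (measurable_ltfSign.comp (by fun_prop)).aestronglyMeasurable
    (ae_of_all _ fun _ => abs_ltfSign_le _)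

/-- Substituting `z ↦ -z` moves the sign onto `f`, so the failure of `ltfSign` to be odd at `0`
never matters. -/
lemma integral_ltfSign_neg_mul (v : EuclideanSpace ℝ (Fin m)) {f : EuclideanSpace ℝ (Fin m) → ℝ}
    (hf : Function.Odd f) :
    ∫ z, ltfSign (inner ℝ (-v) z) * f z ∂(stdGaussian (EuclideanSpace ℝ (Fin m))) =
      -∫ z, ltfSign (inner ℝ v z) * f z ∂(stdGaussian (EuclideanSpace ℝ (Fin m))) := by
  have hmap := stdGaussian_map (LinearIsometryEquiv.neg ℝ (E := EuclideanSpace ℝ (Fin m)))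
  rw [← integral_neg]
  conv_lhs => rw [← hmap]
  refine ((LinearIsometryEquiv.neg ℝ).toHomeomorph.measurableEmbedding.integral_map _).trans ?_
  refine integral_congr_ae (ae_of_all _ fun z => ?_)
  change ltfSign (inner ℝ (-v) (-z)) * f (-z) = _
  rw [inner_neg_neg, hf z, mul_neg]

lemma integral_ltfSign_mul_polyEval (v : EuclideanSpace ℝ (Fin m)) {p : MvPolynomial (Fin m) ℝ}
    {S : Finset (Fin m →₀ ℕ)} (hS : p.support ⊆ S) :
    ∫ z, ltfSign (inner ℝ v z) * polyEval p z ∂(stdGaussian (EuclideanSpace ℝ (Fin m))) =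
      ∑ d ∈ S, p.coeff d * ∫ z, ltfSign (inner ℝ v z) * ∏ i, z i ^ d i
        ∂(stdGaussian (EuclideanSpace ℝ (Fin m))) := by
  have h (z : EuclideanSpace ℝ (Fin m)) : ltfSign (inner ℝ v z) * polyEval p z =
      ∑ d ∈ S, p.coeff d * (ltfSign (inner ℝ v z) * ∏ i, z i ^ d i) := by
    rw [polyEval_eq_sum, Finset.sum_subset hS fun d _ hd => by
      rw [MvPolynomial.notMem_support_iff.1 hd, zero_mul], Finset.mul_sum]
    exact Finset.sum_congr rfl fun d _ => by ring
  simp_rw [h]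
  rw [integral_finsetSum _ fun d _ =>
    (integrable_ltfSign_mul (integrable_monomial_stdGaussian d) v).const_mul _]
  simp_rw [integral_const_mul]

lemma integrable_mixtureLTF_mul {r : ℕ} (v : Fin r → EuclideanSpace ℝ (Fin m)) (w : Fin r → ℝ)
    {f : EuclideanSpace ℝ (Fin m) → ℝ}
    (hf : Integrable f (stdGaussian (EuclideanSpace ℝ (Fin m)))) :
    Integrable (fun z => mixtureLTF v w z * f z) (stdGaussian (EuclideanSpace ℝ (Fin m))) := by
  simp only [mixtureLTF, Finset.sum_mul, mul_assoc]
  exact integrable_finsetSum _ fun l _ => (integrable_ltfSign_mul hf (v l)).const_mul _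

lemma integral_mixtureLTF_mul {r : ℕ} (v : Fin r → EuclideanSpace ℝ (Fin m)) (w : Fin r → ℝ)
    {f : EuclideanSpace ℝ (Fin m) → ℝ}
    (hf : Integrable f (stdGaussian (EuclideanSpace ℝ (Fin m)))) :
    ∫ z, mixtureLTF v w z * f z ∂(stdGaussian (EuclideanSpace ℝ (Fin m))) =
      ∑ l, w l * ∫ z, ltfSign (inner ℝ (v l) z) * f z
        ∂(stdGaussian (EuclideanSpace ℝ (Fin m))) := by
  simp only [mixtureLTF, Finset.sum_mul, mul_assoc]
  rw [integral_finsetSum _ fun l _ => (integrable_ltfSign_mul hf (v l)).const_mul _]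
  simp_rw [integral_const_mul]

/-- If there are more vectors than monomials, then after flipping the signs of some of the vectors
some convex combination of their sign functions is orthogonal to all odd polynomials of low
degree. -/
lemma exists_signs_weights {r k : ℕ} (hr : (m + k).choose k < r)
    (v : Fin r → EuclideanSpace ℝ (Fin m)) :
    ∃ (s w : Fin r → ℝ), (∀ l, s l = 1 ∨ s l = -1) ∧ (∀ l, 0 ≤ w l) ∧ ∑ l, w l = 1 ∧
      ∀ p : MvPolynomial (Fin m) ℝ, Function.Odd (polyEval p) → p.totalDegree ≤ k →
        ∫ z, mixtureLTF (fun l => s l • v l) w z * polyEval p z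
          ∂(stdGaussian (EuclideanSpace ℝ (Fin m))) = 0 := by
  obtain ⟨S, hScard, hS⟩ := exists_finset_degree_le m k
  let L : Fin r → S → ℝ := fun l d => ∫ z, ltfSign (inner ℝ (v l) z) * ∏ i, z i ^ d.1 i
    ∂(stdGaussian (EuclideanSpace ℝ (Fin m)))
  have hdep : ¬ LinearIndependent ℝ L := fun h => by
    have := h.fintype_card_le_finrank
    simp only [Fintype.card_fin, Module.finrank_fintype_fun_eq_card, Fintype.card_coe] at this
    omega
  obtain ⟨a, ha, l₀, hl₀⟩ := Fintype.not_linearIndependent_iff.1 hdep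
  have hA : 0 < ∑ l, |a l| :=
    Finset.sum_pos' (fun _ _ => abs_nonneg _) ⟨l₀, Finset.mem_univ _, abs_pos.2 hl₀⟩
  refine ⟨fun l => if 0 ≤ a l then 1 else -1, fun l => |a l| / ∑ l, |a l|, fun l => ?_,
    fun l => by positivity, ?_, fun p hodd hdeg => ?_⟩
  · by_cases h : 0 ≤ a l <;> simp [h]
  · rw [← Finset.sum_div, div_self hA.ne']
  have hsupp : p.support ⊆ S := fun d hd => hS d ((MvPolynomial.le_totalDegree hd).trans hdeg)
  rw [integral_mixtureLTF_mul _ _ (integrable_polyEval p)]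
  have hterm (l : Fin r) : |a l| / (∑ l, |a l|) *
      ∫ z, ltfSign (inner ℝ ((if 0 ≤ a l then (1 : ℝ) else -1) • v l) z) * polyEval p z
        ∂(stdGaussian (EuclideanSpace ℝ (Fin m))) =
      (∑ l, |a l|)⁻¹ * (a l * ∫ z, ltfSign (inner ℝ (v l) z) * polyEval p z
        ∂(stdGaussian (EuclideanSpace ℝ (Fin m)))) := by
    by_cases h : 0 ≤ a l
    · rw [if_pos h, one_smul, abs_of_nonneg h]
      ring
    · rw [if_neg h, neg_one_smul, integral_ltfSign_neg_mul _ hodd, abs_of_neg (not_le.1 h)]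
      ring
  rw [Finset.sum_congr rfl fun l _ => hterm l, ← Finset.mul_sum]
  refine mul_eq_zero_of_right _ ?_
  simp_rw [integral_ltfSign_mul_polyEval _ hsupp, Finset.mul_sum]
  rw [Finset.sum_comm]
  refine Finset.sum_eq_zero fun d hd => ?_
  have := congrFun ha ⟨d, hd⟩
  simp only [Finset.sum_apply, Pi.smul_apply, smul_eq_mul, Pi.zero_apply, L] at this
  rw [← mul_zero (p.coeff d), ← this, Finset.mul_sum]
  exact Finset.sum_congr rfl fun l _ => by ring

end Gaussian

/-- The relation between `m`, `r` and `Δ` forces `m ≥ 20` and `r ≤ Δ ^ (-(m - 1))`. -/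
lemma dimension_bounds {c Δ : ℝ} {m r : ℕ} (hc : 1.99 ≤ c) (hr : 2 ≤ r)
    (hΔ : (r : ℝ) ^ (-(1 / 10) : ℝ) ≤ Δ) (hΔ1 : Δ < 1)
    (hm : (m : ℝ) = c * Real.log r / Real.log (1 / Δ)) :
    0 < Δ ∧ 20 ≤ m ∧ r * Δ ^ (m - 1) ≤ 1 := by
  have hr0 : (0 : ℝ) < r := by positivity
  have hΔ0 : 0 < Δ := (Real.rpow_pos_of_pos hr0 _).trans_le hΔ
  have hlogr : 0 < Real.log r := Real.log_pos (by exact_mod_cast hr)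
  have hL : Real.log (1 / Δ) = -Real.log Δ := by rw [one_div, Real.log_inv]
  have hL0 : 0 < -Real.log Δ := neg_pos.2 (Real.log_neg hΔ0 hΔ1)
  have hL1 : -Real.log Δ ≤ Real.log r / 10 := by
    have := Real.log_le_log (Real.rpow_pos_of_pos hr0 _) hΔ
    rw [Real.log_rpow hr0] at this
    linarith
  rw [hL, eq_div_iff hL0.ne'] at hm
  -- The estimates give only `m ≥ 10 * c ≥ 19.9`; integrality does the rest.
  have hm20 : 20 ≤ m := by
    by_contra! h
    have h19 : (m : ℝ) ≤ 19 := by exact_mod_cast Nat.le_of_lt_succ h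
    nlinarith
  refine ⟨hΔ0, hm20, ?_⟩
  have hm20' : (20 : ℝ) ≤ m := by exact_mod_cast hm20
  rw [← Real.log_nonpos_iff (by positivity), Real.log_mul hr0.ne' (by positivity), Real.log_pow,
    Nat.cast_sub (by omega)]
  push_cast
  -- `(m - 1) * (-log Δ) = c * log r + log Δ ≥ (1.99 - 0.1) * log r`.
  nlinarith

theorem proposition3p3 :
    ∃ C > (0 : ℝ), ∃ ε > (0 : ℝ),
      ∀ (c : ℝ), 1.99 ≤ c → c ≤ 2 →
      ∀ (m r k : ℕ) (Δ : ℝ),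
        (r : ℝ) ^ (-(1 / 10) : ℝ) ≤ Δ → Δ < 1 →
        (m : ℝ) = c * Real.log r / Real.log (1 / Δ) →
        1 ≤ k →
        C * (Nat.choose (m + k) k : ℝ) ≤ (r : ℝ) →
        ∃ (v : Fin r → EuclideanSpace ℝ (Fin m)) (w : Fin r → ℝ),
          (∀ l, v l ∈ Metric.sphere (0 : EuclideanSpace ℝ (Fin m)) 1) ∧
          (∀ l, 0 ≤ w l) ∧
          ∑ l, w l = 1 ∧
          (∀ p : MvPolynomial (Fin m) ℝ, Function.Odd (polyEval p) → p.totalDegree < k →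
            Integrable (fun z => mixtureLTF v w z * polyEval p z)
              (stdGaussian (EuclideanSpace ℝ (Fin m))) ∧
            ∫ z, mixtureLTF v w z * polyEval p z
              ∂(stdGaussian (EuclideanSpace ℝ (Fin m))) = 0) ∧
          (∀ i j : Fin r, i < j → ε * Δ ≤ ‖v i + v j‖ ∧ ε * Δ ≤ ‖v i - v j‖) := by

  -- As the binomial is positive, `C = 2` makes it strictly less than `r` and forces `r ≥ 2`. With
  -- `ε = 1 / 16` the base `2 * δ` is `Δ / 8`, whose powers of `1 / 8` absorb the constants of the
  -- packing condition.
  refine ⟨2, two_pos, 1 / 16, by norm_num, fun c hc _ m r k Δ hΔ hΔ1 hm _ hr => ?_⟩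
  have hchoose : 0 < (m + k).choose k := Nat.choose_pos (Nat.le_add_left k m)
  have hr' : 2 * (m + k).choose k ≤ r := by exact_mod_cast hr
  obtain ⟨hΔ0, hm20, hrΔ⟩ := dimension_bounds hc (by omega) hΔ hΔ1 hm
  have : Nontrivial (EuclideanSpace ℝ (Fin m)) :=
    Module.nontrivial_of_finrank_pos (R := ℝ) (by rw [finrank_euclideanSpace_fin]; omega)
  have hpack : 4 * r * (2 * (1 / 16 * Δ)) ^ Module.finrank ℝ (EuclideanSpace ℝ (Fin m)) ≤
      1 / 16 * Δ := by
    rw [finrank_euclideanSpace_fin]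
    obtain ⟨n, rfl⟩ : ∃ n, m = n + 1 := ⟨m - 1, by omega⟩
    rw [Nat.add_sub_cancel] at hrΔ
    have h8 : (1 / 8 : ℝ) ^ n ≤ 1 / 8 :=
      (pow_le_pow_of_le_one (by norm_num) (by norm_num) (by omega : 1 ≤ n)).trans_eq (pow_one _)
    calc 4 * (r : ℝ) * (2 * (1 / 16 * Δ)) ^ (n + 1)
        = 1 / 2 * Δ * ((1 / 8) ^ n * (r * Δ ^ n)) := by
          rw [show 2 * (1 / 16 * Δ) = 1 / 8 * Δ by ring, mul_pow, pow_succ, pow_succ]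
          ring
      _ ≤ 1 / 2 * Δ * (1 / 8 * 1) := by gcongr
      _ = 1 / 16 * Δ := by ring
  obtain ⟨v, hv, hsep⟩ := exists_sphere_family_separated (by positivity) (by linarith) r hpack
  obtain ⟨s, w, hs, hw, hw1, hint⟩ := exists_signs_weights (k := k) (by omega) v
  refine ⟨fun l => s l • v l, w, fun l => ?_, hw, hw1, fun p hodd hdeg =>
    ⟨integrable_mixtureLTF_mul _ _ (integrable_polyEval p), hint p hodd hdeg.le⟩,
    fun i j hij => ?_⟩
  · rw [mem_sphere_zero_iff_norm, norm_smul, hv]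
    rcases hs l with h | h <;> simp [h]
  · obtain ⟨h1, h2⟩ := hsep i j hij.ne
    rcases hs i with hi | hi <;> rcases hs j with hj | hj <;>
      simp only [hi, hj, one_smul, neg_one_smul]
    · exact ⟨h1, h2⟩
    · exact ⟨by rwa [← sub_eq_add_neg], by rwa [sub_neg_eq_add]⟩
    · exact ⟨by rwa [neg_add_eq_sub, norm_sub_rev], by rwa [← neg_add', norm_neg]⟩
    · exact ⟨by rwa [← neg_add, norm_neg], by rwa [neg_sub_neg, norm_sub_rev]⟩
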